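/- Let $n \ge 1$, let $I$ be the $n\times n$ identity matrix and $e\in\mathbb{R}^n$ the all-ones vector. Let $W\in\mathbb{R}^{n\times n}$ be row-stochastic (entrywise nonnegative with $We=e$) and primitive (there is $m\ge 1$ such that all entries of $W^m$ are positive), and let $\pi\in\mathbb{R}^n$ be its left Perron vector, i.e. the entrywise positive vector with $\pi^\top W=\pi^\top$ and $\pi^\top e=1$. Let $B\in\mathbb{R}^{n\times n}$ satisfy $\pi^\top B e>0$. Then there exists $T>0$ such that for all $0<t<T$ the matrix $I+tB$ is invertible and the matrices $$P(t)=W(I-tB),\qquad R(t)=I-W+(I+tB)^{-1}(2W-I)$$ are both Schur stable, that is, $\varrho(P(t))<1$ and $\varrho(R(t))<1$, where $\varrho(M)=\max\{|\lambda| : \lambda\in\mathbb{C}\text{ is an eigenvalue of }M\}$ denotes the spectral radius. -/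

import Mathlib

open scoped Matrix

noncomputable section

/-- `π` is the left Perron vector of `W`: the entrywise positive left eigenvector of `W` for the
eigenvalue `1`, normalized so that its entries sum to `1`. -/
structure IsLeftPerronVector {n : ℕ} (W : Matrix (Fin n) (Fin n) ℝ) (π : Fin n → ℝ) : Prop where
  pos : ∀ i, 0 < π i
  vecMul_eq : π ᵥ* W = π
  dotProduct_one : π ⬝ᵥ 1 = 1

/-- The spectral radius of a real square matrix: the supremum of `|λ|` over its *complex*
eigenvalues `λ`. -/
def specRadius {n : ℕ} (M : Matrix (Fin n) (Fin n) ℝ) : ENNReal :=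
  spectralRadius ℂ (M.map (algebraMap ℝ ℂ))

/-- A real square matrix is Schur stable if all its complex eigenvalues lie in the open unit
disk, i.e. its spectral radius is less than `1`. -/
def IsSchurStable {n : ℕ} (M : Matrix (Fin n) (Fin n) ℝ) : Prop :=
  specRadius M < 1

/-- `P(t) = W (I - tB)`. -/
def matP {n : ℕ} (W B : Matrix (Fin n) (Fin n) ℝ) (t : ℝ) : Matrix (Fin n) (Fin n) ℝ :=
  W * (1 - t • B)

/-- `R(t) = I - W + (I + tB)⁻¹ (2W - I)`; meaningful when `I + tB` is invertible. -/
def matR {n : ℕ} (W B : Matrix (Fin n) (Fin n) ℝ) (t : ℝ) : Matrix (Fin n) (Fin n) ℝ :=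
  1 - W + (1 + t • B)⁻¹ * ((2 : ℝ) • W - 1)

end

open Filter Topology

/-! Since `(I + tB)⁻¹ = I - t (I + tB)⁻¹ B`, both matrices have the form `W - t A(t)`: `A = W B` for
`P`, and `A(t) = (I + tB)⁻¹ B (2W - I)` for `R`. As `πW = π` and `(2W - I)e = e`, both limits `A₀`
satisfy `π A₀ e = π B e > 0`. To first order the eigenvalue `1` of `W` thus moves to `1 - t π B e`,
while the others already lie inside the unit disk.

Compactness replaces eigenvalue perturbation theory. If eigenvalues with `|μ| ≥ 1` persisted as `t →
0⁺`, a limit of the eigenpairs would be an eigenpair of `W`, so by primitivity `μ → 1` and the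
eigenvectors tend to a constant vector. Pairing with `π` then gives `μ = 1 - t g(t)` with `g → π A₀
e > 0`, which forces `|μ| < 1`. -/

/-- If `g t → a > 0` as `t → 0⁺`, then `1 - t g(t)` cannot stay outside the open unit disk. -/
theorem false_of_one_le_norm_one_sub_mul {l : Filter ℝ} [l.NeBot]
    (ht0 : Tendsto (fun t : ℝ => t) l (𝓝 0)) (hpos : ∀ᶠ t in l, 0 < t) {g : ℝ → ℂ} {a : ℝ}
    (ha : 0 < a) (hg : Tendsto g l (𝓝 (a : ℂ))) (h : ∀ᶠ t : ℝ in l, 1 ≤ ‖1 - t * g t‖) :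
    False := by
  -- Expand `|1 - t g|² ≥ 1` and divide by `t`; the limit reads `0 ≤ -2a`.
  have hineq : ∀ᶠ t in l, 0 ≤ t * Complex.normSq (g t) - 2 * (g t).re := by
    filter_upwards [h, hpos] with t ht ht0
    have h₁ : 1 ≤ Complex.normSq (1 - t * g t) := by
      rw [Complex.normSq_eq_norm_sq]
      exact one_le_pow₀ ht
    have h₂ : Complex.normSq (1 - t * g t)
        = 1 + t * (t * Complex.normSq (g t) - 2 * (g t).re) := by
      simp [Complex.normSq_apply]
      ring
    rw [h₂] at h₁
    exact nonneg_of_mul_nonneg_right (by linarith) ht0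
  have hlim := (ht0.mul ((Complex.continuous_normSq.tendsto _).comp hg)).sub
    (((Complex.continuous_re.tendsto _).comp hg).const_mul 2)
  have := ge_of_tendsto hlim hineq
  rw [Complex.ofReal_re] at this
  linarith

namespace Matrix

theorem _root_.Filter.Tendsto.matrix_mulVec {α ι R : Type*} [Fintype ι] [TopologicalSpace R]
    [NonUnitalNonAssocSemiring R] [ContinuousAdd R] [ContinuousMul R] {l : Filter α}
    {M : α → Matrix ι ι R} {M₀ : Matrix ι ι R} {v : α → ι → R} {v₀ : ι → R}
    (hM : Tendsto M l (𝓝 M₀)) (hv : Tendsto v l (𝓝 v₀)) :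
    Tendsto (fun t => M t *ᵥ v t) l (𝓝 (M₀ *ᵥ v₀)) := by
  have h : Continuous fun q : Matrix ι ι R × (ι → R) => q.1 *ᵥ q.2 :=
    continuous_fst.matrix_mulVec continuous_snd
  exact (h.tendsto (M₀, v₀)).comp (hM.prodMk_nhds hv)

theorem tendsto_map_ofReal {α ι : Type*} {l : Filter α} {M : α → Matrix ι ι ℝ} {M₀ : Matrix ι ι ℝ}
    (hM : Tendsto M l (𝓝 M₀)) :
    Tendsto (fun t => (M t).map (algebraMap ℝ ℂ)) l (𝓝 (M₀.map (algebraMap ℝ ℂ))) := by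
  have h : Continuous fun N : Matrix ι ι ℝ => N.map (algebraMap ℝ ℂ) :=
    continuous_id.matrix_map Complex.continuous_ofReal
  exact (h.tendsto M₀).comp hM

variable {ι : Type*} [Fintype ι] [DecidableEq ι]

/-- An eigenvector of a positive row-stochastic matrix for an eigenvalue of modulus at least `1`
is constant. -/
theorem eigenvector_const_of_pos_rowStochastic {Q : Matrix ι ι ℝ}
    (hQ : Q ∈ rowStochastic ℝ ι) (hpos : ∀ i j, 0 < Q i j) {v : ι → ℂ} {μ : ℂ}
    (hμ : 1 ≤ ‖μ‖) (hv : Q.map (algebraMap ℝ ℂ) *ᵥ v = μ • v) :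
    ∃ c : ℂ, v = fun _ => c := by
  cases isEmpty_or_nonempty ι
  · exact ⟨0, Subsingleton.elim _ _⟩
  obtain ⟨i, hi⟩ := Finite.exists_max fun j => ‖v j‖
  -- `u` is an average of the `v j` with positive weights `Q i j`, and no `v j` exceeds it in
  -- modulus. Equality in the triangle inequality forces every `v j = u`.
  set u : ℂ := μ * v i with hu
  have hle : ∀ j, ‖v j‖ ≤ ‖u‖ := fun j => by
    rw [hu, norm_mul]
    nlinarith [hi j, norm_nonneg (v i)]
  have hsum : ∑ j, (Q i j : ℂ) * v j = u := by
    simpa [mulVec, dotProduct] using congrFun hv i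
  have hterm : ∀ j, 0 ≤ Complex.normSq u - ((starRingEnd ℂ) u * v j).re := fun j => by
    have h₁ := Complex.re_le_norm ((starRingEnd ℂ) u * v j)
    rw [norm_mul, RCLike.norm_conj] at h₁
    rw [Complex.normSq_eq_norm_sq]
    nlinarith [hle j, norm_nonneg u]
  have hzero : ∑ j, Q i j * (Complex.normSq u - ((starRingEnd ℂ) u * v j).re) = 0 := by
    have h₁ : ∑ j, Q i j * ((starRingEnd ℂ) u * v j).re = Complex.normSq u := by
      have := congrArg (fun z => ((starRingEnd ℂ) u * z).re) hsum
      simp only [Finset.mul_sum, Complex.re_sum] at this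
      rw [mul_comm _ u, Complex.mul_conj, Complex.ofReal_re] at this
      rw [← this]
      refine Finset.sum_congr rfl fun j _ => ?_
      rw [mul_left_comm, Complex.re_ofReal_mul]
    simp only [mul_sub, Finset.sum_sub_distrib]
    rw [h₁, ← Finset.sum_mul, sum_row_of_mem_rowStochastic hQ, one_mul, sub_self]
  refine ⟨u, funext fun j => ?_⟩
  have hj := (Finset.sum_eq_zero_iff_of_nonneg fun j _ =>
    mul_nonneg (hpos i j).le (hterm j)).1 hzero j (Finset.mem_univ j)
  have hj' := (mul_eq_zero.1 hj).resolve_left (hpos i j).ne'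
  have hn : Complex.normSq (v j) ≤ Complex.normSq u := by
    rw [Complex.normSq_eq_norm_sq, Complex.normSq_eq_norm_sq]
    exact pow_le_pow_left₀ (norm_nonneg _) (hle j) 2
  have : Complex.normSq (v j - u) ≤ 0 := by
    rw [Complex.normSq_sub]
    have : (v j * (starRingEnd ℂ) u).re = Complex.normSq u := by rw [mul_comm]; linarith
    linarith
  exact sub_eq_zero.1 (Complex.normSq_eq_zero.1 (le_antisymm this (Complex.normSq_nonneg _)))

theorem pow_mulVec_of_mulVec_eq_smul {M : Matrix ι ι ℂ} {v : ι → ℂ} {μ : ℂ}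
    (hv : M *ᵥ v = μ • v) (k : ℕ) : (M ^ k) *ᵥ v = μ ^ k • v := by
  induction k with
  | zero => simp
  | succ k ih => rw [pow_succ, ← mulVec_mulVec, hv, mulVec_smul, ih, smul_smul, pow_succ']

/-- The peripheral spectrum of a primitive row-stochastic matrix is the simple eigenvalue `1`,
with constant eigenvectors. -/
theorem IsPrimitive.eigenpair_of_one_le_norm {W : Matrix ι ι ℝ} (hprim : W.IsPrimitive)
    (hW : W ∈ rowStochastic ℝ ι) {v : ι → ℂ} {μ : ℂ} (hμ : 1 ≤ ‖μ‖) (hv0 : v ≠ 0)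
    (hv : W.map (algebraMap ℝ ℂ) *ᵥ v = μ • v) :
    μ = 1 ∧ ∃ c : ℂ, c ≠ 0 ∧ v = fun _ => c := by
  obtain ⟨k, -, hk⟩ := hprim.exists_pos_pow
  have hvk : (W ^ k).map (algebraMap ℝ ℂ) *ᵥ v = μ ^ k • v := by
    rw [Matrix.map_pow]
    exact pow_mulVec_of_mulVec_eq_smul hv k
  obtain ⟨c, rfl⟩ := eigenvector_const_of_pos_rowStochastic (pow_mem hW k) hk
    (by rw [norm_pow]; exact one_le_pow₀ hμ) hvk
  obtain ⟨i, hi⟩ := Function.ne_iff.1 hv0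
  have hc : c ≠ 0 := hi
  refine ⟨?_, c, hc, rfl⟩
  have h₁ : ∑ j, (W i j : ℂ) * c = μ * c := by
    simpa [mulVec, dotProduct] using congrFun hv i
  rw [← Finset.sum_mul, ← Complex.ofReal_sum, sum_row_of_mem_rowStochastic hW,
    Complex.ofReal_one] at h₁
  exact (mul_right_cancel₀ hc h₁).symm

/-- Every spectral value of a complex matrix has an eigenvector of norm `1`. -/
theorem exists_unit_eigenvector {M : Matrix ι ι ℂ} {μ : ℂ} (hμ : μ ∈ spectrum ℂ M) :
    ∃ v : ι → ℂ, ‖v‖ = 1 ∧ M *ᵥ v = μ • v := by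
  rw [spectrum.mem_iff, isUnit_iff_isUnit_det, isUnit_iff_ne_zero, not_not] at hμ
  obtain ⟨v, hv0, hv⟩ := exists_mulVec_eq_zero_iff.2 hμ
  have hv' : M *ᵥ v = μ • v := by
    rw [sub_mulVec, Algebra.algebraMap_eq_smul_one, smul_mulVec, one_mulVec, sub_eq_zero] at hv
    exact hv.symm
  refine ⟨(‖v‖⁻¹ : ℂ) • v, ?_, ?_⟩
  · rw [norm_smul, norm_inv, Complex.norm_real, norm_norm, inv_mul_cancel₀ (norm_ne_zero_iff.2 hv0)]
  · rw [mulVec_smul, hv', smul_comm]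

/-- First-order perturbation of the Perron eigenvalue: unit-or-larger eigenvalues of `W - t A(t)`
cannot have eigenvectors converging to a nonzero constant vector as `t → 0⁺` when the derivative
`-π A(0) e` of the Perron eigenvalue is negative. -/
theorem false_of_eigenpairs_tendsto_const {W : Matrix ι ι ℝ} {π : ι → ℝ}
    (hπ : π ᵥ* W = π) (hπ1 : π ⬝ᵥ 1 = 1) {l : Filter ℝ} [l.NeBot]
    (ht0 : Tendsto (fun t : ℝ => t) l (𝓝 0)) (hpos : ∀ᶠ t in l, 0 < t)
    {A : ℝ → Matrix ι ι ℝ} {A₀ : Matrix ι ι ℝ} (hA : Tendsto A l (𝓝 A₀))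
    (hA₀ : 0 < π ⬝ᵥ (A₀ *ᵥ 1)) {μ : ℝ → ℂ} {v : ℝ → ι → ℂ} {c : ℂ} (hc : c ≠ 0)
    (hμ : ∀ᶠ t in l, 1 ≤ ‖μ t‖) (hv : Tendsto v l (𝓝 fun _ => c))
    (heig : ∀ᶠ t in l, (W - t • A t).map (algebraMap ℝ ℂ) *ᵥ v t = μ t • v t) : False := by
  obtain ⟨ρ, hρ⟩ : ∃ ρ : ι → ℂ, ρ = fun i => (π i : ℂ) := ⟨_, rfl⟩
  have hρW : ρ ᵥ* W.map (algebraMap ℝ ℂ) = ρ := by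
    ext j
    have := congrArg (algebraMap ℝ ℂ) (congrFun hπ j)
    simpa [vecMul, dotProduct, hρ] using this
  have hdot : Continuous fun w : ι → ℂ => ρ ⬝ᵥ w := continuous_const.dotProduct continuous_id
  have hρc : ρ ⬝ᵥ (fun _ => c) = c := by
    have : ∑ i, (π i : ℂ) = 1 := by
      rw [← Complex.ofReal_sum]
      simpa [dotProduct] using congrArg (algebraMap ℝ ℂ) hπ1
    simp only [dotProduct, hρ]
    rw [← Finset.sum_mul, this, one_mul]
  have hρA : ρ ⬝ᵥ (A₀.map (algebraMap ℝ ℂ) *ᵥ fun _ => c) = ((π ⬝ᵥ (A₀ *ᵥ 1) : ℝ) : ℂ) * c := by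
    simp [dotProduct, mulVec, hρ, Finset.sum_mul, Finset.mul_sum, mul_assoc]
  have hden : Tendsto (fun t => ρ ⬝ᵥ v t) l (𝓝 c) := by
    simpa [hρc, Function.comp_def] using (hdot.tendsto _).comp hv
  have hAv : Tendsto (fun t => (A t).map (algebraMap ℝ ℂ) *ᵥ v t) l
      (𝓝 (A₀.map (algebraMap ℝ ℂ) *ᵥ fun _ => c)) :=
    (tendsto_map_ofReal hA).matrix_mulVec hv
  have hnum : Tendsto (fun t => ρ ⬝ᵥ ((A t).map (algebraMap ℝ ℂ) *ᵥ v t)) l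
      (𝓝 (((π ⬝ᵥ (A₀ *ᵥ 1) : ℝ) : ℂ) * c)) := by
    rw [← hρA]
    exact (hdot.tendsto _).comp hAv
  -- Since `ρ` is fixed by `W`, pairing the eigenvalue equation with it gives `μ (ρ ⬝ v) = ρ ⬝ v - t
  -- ρ ⬝ (A v)`. The divisor `ρ ⬝ v` tends to `c ≠ 0`.
  obtain ⟨g, hg⟩ : ∃ g : ℝ → ℂ, g = fun t =>
    (ρ ⬝ᵥ ((A t).map (algebraMap ℝ ℂ) *ᵥ v t)) / (ρ ⬝ᵥ v t) := ⟨_, rfl⟩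
  have hgU : Tendsto g l (𝓝 ((π ⬝ᵥ (A₀ *ᵥ 1) : ℝ) : ℂ)) := by
    rw [hg]
    have := hnum.div hden hc
    rwa [mul_div_cancel_right₀ _ hc] at this
  have hlam : ∀ᶠ t in l, μ t = 1 - t * g t := by
    filter_upwards [heig, hden.eventually_ne hc] with t ht hne
    have h₁ := congrArg (fun w => ρ ⬝ᵥ w) ht
    have h₂ : (W - t • A t).map (algebraMap ℝ ℂ)
        = W.map (algebraMap ℝ ℂ) - (t : ℂ) • (A t).map (algebraMap ℝ ℂ) := by
      ext i j
      simp
    simp only [h₂, sub_mulVec, dotProduct_sub, smul_mulVec, dotProduct_smul, smul_eq_mul] at h₁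
    rw [dotProduct_mulVec, hρW] at h₁
    rw [hg]
    field_simp
    linear_combination -h₁
  exact false_of_one_le_norm_one_sub_mul ht0 hpos hA₀ hgU (by
    filter_upwards [hμ, hlam] with t ht hl
    rwa [← hl])

/-- Perturbing a primitive row-stochastic matrix `W` to `W - t A(t)`, where `π A(0) e > 0` for the
left Perron vector `π`, moves all eigenvalues into the open unit disk for small `t > 0`. -/
theorem eventually_norm_lt_one_of_mem_spectrum_sub_smul {W : Matrix ι ι ℝ} {π : ι → ℝ}
    (hprim : W.IsPrimitive) (hW : W ∈ rowStochastic ℝ ι) (hπ : π ᵥ* W = π) (hπ1 : π ⬝ᵥ 1 = 1)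
    {A : ℝ → Matrix ι ι ℝ} {A₀ : Matrix ι ι ℝ} (hA : Tendsto A (𝓝[>] 0) (𝓝 A₀))
    (hA₀ : 0 < π ⬝ᵥ (A₀ *ᵥ 1)) :
    ∀ᶠ t in 𝓝[>] (0 : ℝ), ∀ μ ∈ spectrum ℂ ((W - t • A t).map (algebraMap ℝ ℂ)), ‖μ‖ < 1 := by
  by_contra hcon
  have : NeBot (𝓝[>] (0 : ℝ) ⊓ 𝓟 {t | ∃ p : ℂ × (ι → ℂ), 1 ≤ ‖p.1‖ ∧ ‖p.2‖ = 1 ∧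
      (W - t • A t).map (algebraMap ℝ ℂ) *ᵥ p.2 = p.1 • p.2}) := by
    refine frequently_mem_iff_neBot.1 ((not_eventually.1 hcon).mono fun t ht => ?_)
    push Not at ht
    obtain ⟨μ, hμ, hμ1⟩ := ht
    obtain ⟨v, hv, hv'⟩ := exists_unit_eigenvector hμ
    exact ⟨(μ, v), hμ1, hv, hv'⟩
  -- Along an ultrafilter anything eventually in a compact set converges, so no subsequences are
  -- needed.
  obtain ⟨U, hUle⟩ := exists_ultrafilter_le (𝓝[>] (0 : ℝ) ⊓ 𝓟 {t | ∃ p : ℂ × (ι → ℂ), 1 ≤ ‖p.1‖ ∧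
      ‖p.2‖ = 1 ∧ (W - t • A t).map (algebraMap ℝ ℂ) *ᵥ p.2 = p.1 • p.2})
  have hU0 : (U : Filter ℝ) ≤ 𝓝[>] 0 := hUle.trans inf_le_left
  have hUp : ∀ᶠ t in (U : Filter ℝ), ∃ p : ℂ × (ι → ℂ), 1 ≤ ‖p.1‖ ∧ ‖p.2‖ = 1 ∧
      (W - t • A t).map (algebraMap ℝ ℂ) *ᵥ p.2 = p.1 • p.2 := le_principal_iff.1 (hUle.trans inf_le_right)
  obtain ⟨p, hp⟩ := hUp.choice
  have hpos : ∀ᶠ t in (U : Filter ℝ), 0 < t := hU0 self_mem_nhdsWithin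
  have ht0 : Tendsto (fun t : ℝ => t) U (𝓝 0) := hU0.trans nhdsWithin_le_nhds
  have hAU : Tendsto A U (𝓝 A₀) := hA.mono_left hU0
  -- the eigenvectors converge along `U`
  obtain ⟨v, hv, hvU⟩ := (isCompact_sphere (0 : ι → ℂ) 1).ultrafilter_le_nhds'
    (U.map fun t => (p t).2) (hp.mono fun t ht => by simpa using ht.2.1)
  have hv0 : v ≠ 0 := ne_zero_of_mem_unit_sphere ⟨v, hv⟩
  have hvU : Tendsto (fun t => (p t).2) U (𝓝 v) := hvU
  have hMv : Tendsto (fun t => (p t).1 • (p t).2) U (𝓝 (W.map (algebraMap ℝ ℂ) *ᵥ v)) := by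
    have h₁ : Tendsto (fun t => W - t • A t) U (𝓝 W) := by
      simpa using (tendsto_const_nhds (x := W)).sub (ht0.smul hAU)
    refine ((tendsto_map_ofReal h₁).matrix_mulVec hvU).congr' ?_
    filter_upwards [hp] with t ht using ht.2.2
  -- the eigenvalues stay bounded, hence converge along `U` as well
  have hbdd : ∀ᶠ t in (U : Filter ℝ),
      (p t).1 ∈ Metric.closedBall (0 : ℂ) (‖W.map (algebraMap ℝ ℂ) *ᵥ v‖ + 1) := by
    filter_upwards [hp, hMv.norm.eventually_lt_const (lt_add_one _)] with t ht hlt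
    rw [norm_smul, ht.2.1, mul_one] at hlt
    simpa using hlt.le
  obtain ⟨μ, -, hμU⟩ := (isCompact_closedBall (0 : ℂ) _).ultrafilter_le_nhds'
    (U.map fun t => (p t).1) hbdd
  have hμU : Tendsto (fun t => (p t).1) U (𝓝 μ) := hμU
  obtain ⟨-, c, hc, rfl⟩ := hprim.eigenpair_of_one_le_norm hW
    (ge_of_tendsto hμU.norm (hp.mono fun t ht => ht.1)) hv0
    (tendsto_nhds_unique hMv (hμU.smul hvU))
  exact false_of_eigenpairs_tendsto_const hπ hπ1 ht0 hpos hAU hA₀ hc (hp.mono fun t ht => ht.1) hvU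
    (hp.mono fun t ht => ht.2.2)

end Matrix

/-- The spectrum is compact and, for `n ≠ 0`, nonempty, so the supremum is attained and the bound
stays strict. The norm only supplies a Banach algebra structure. -/
theorem isSchurStable_of_forall_norm_lt_one {n : ℕ} [NeZero n] {M : Matrix (Fin n) (Fin n) ℝ}
    (h : ∀ μ ∈ spectrum ℂ (M.map (algebraMap ℝ ℂ)), ‖μ‖ < 1) : IsSchurStable M := by
  let : NormedRing (Matrix (Fin n) (Fin n) ℂ) := Matrix.linftyOpNormedRing
  let : NormedAlgebra ℂ (Matrix (Fin n) (Fin n) ℂ) := Matrix.linftyOpNormedAlgebra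
  exact spectrum.spectralRadius_lt_of_forall_lt _ (r := 1) fun z hz => h z hz

theorem mainTheorem1 {n : ℕ} (W B : Matrix (Fin n) (Fin n) ℝ) (π : Fin n → ℝ)
    (hW : W ∈ Matrix.rowStochastic ℝ (Fin n)) (hprim : W.IsPrimitive)
    (hπ : IsLeftPerronVector W π) (hB : 0 < π ⬝ᵥ (B *ᵥ 1)) :
    ∃ T : ℝ, 0 < T ∧ ∀ t : ℝ, 0 < t → t < T →
      IsUnit (1 + t • B) ∧ IsSchurStable (matP W B t) ∧ IsSchurStable (matR W B t) := by
  have hn : NeZero n := ⟨by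
    rintro rfl
    have h := hπ.dotProduct_one
    simp at h⟩
  have hW1 : W *ᵥ 1 = 1 := hW.2
  have hcont : Continuous fun t : ℝ => 1 + t • B := by fun_prop
  have hunit : ∀ᶠ t in 𝓝[>] (0 : ℝ), IsUnit (1 + t • B) := by
    have h0 : (1 + (0 : ℝ) • B).det ≠ 0 := by simp
    filter_upwards [nhdsWithin_le_nhds (hcont.matrix_det.continuousAt.eventually_ne h0)] with t ht
    exact (Matrix.isUnit_iff_isUnit_det _).2 ht.isUnit
  have hinv : Tendsto (fun t : ℝ => (1 + t • B)⁻¹) (𝓝[>] 0) (𝓝 1) := by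
    have h0 : ContinuousAt Ring.inverse (1 + (0 : ℝ) • B).det := by
      simp
    have := (continuousAt_matrix_inv _ h0).tendsto.comp
      ((hcont.tendsto 0).mono_left (nhdsWithin_le_nhds (s := Set.Ioi 0)))
    rw [zero_smul, add_zero, inv_one] at this
    exact this
  have hP := Matrix.eventually_norm_lt_one_of_mem_spectrum_sub_smul hprim hW hπ.vecMul_eq
    hπ.dotProduct_one (A := fun _ => W * B) (A₀ := W * B) tendsto_const_nhds
    (by rwa [← Matrix.mulVec_mulVec, Matrix.dotProduct_mulVec, hπ.vecMul_eq])
  have hR := Matrix.eventually_norm_lt_one_of_mem_spectrum_sub_smul hprim hW hπ.vecMul_eq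
    hπ.dotProduct_one (A := fun t => (1 + t • B)⁻¹ * (B * ((2 : ℝ) • W - 1)))
    (A₀ := B * ((2 : ℝ) • W - 1)) (by simpa using hinv.mul_const (B * ((2 : ℝ) • W - 1))) (by
      have : ((2 : ℝ) • W - 1) *ᵥ 1 = 1 := by
        rw [Matrix.sub_mulVec, Matrix.smul_mulVec, hW1, Matrix.one_mulVec, two_smul, add_sub_cancel_right]
      rwa [← Matrix.mulVec_mulVec, this])
  obtain ⟨T, hT, hall⟩ := mem_nhdsGT_iff_exists_Ioo_subset.1 ((hunit.and hP).and hR)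
  refine ⟨T, hT, fun t ht htT => ?_⟩
  obtain ⟨⟨hu, hp⟩, hr⟩ := hall ⟨ht, htT⟩
  refine ⟨hu, isSchurStable_of_forall_norm_lt_one ?_, isSchurStable_of_forall_norm_lt_one ?_⟩
  · have : matP W B t = W - t • (W * B) := by simp [matP, mul_sub]
    rwa [this]
  · have : matR W B t = W - t • ((1 + t • B)⁻¹ * (B * ((2 : ℝ) • W - 1))) := by
      have h₁ : (1 + t • B)⁻¹ * (1 + t • B) = 1 :=
        Matrix.nonsing_inv_mul _ ((Matrix.isUnit_iff_isUnit_det _).1 hu)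
      have h₂ : (1 + t • B)⁻¹ = 1 - t • ((1 + t • B)⁻¹ * B) := by
        rw [mul_add, mul_one, mul_smul_comm] at h₁
        exact eq_sub_of_add_eq h₁
      have h₃ : (1 + t • B)⁻¹ * ((2 : ℝ) • W - 1)
          = (2 : ℝ) • W - 1 - t • ((1 + t • B)⁻¹ * (B * ((2 : ℝ) • W - 1))) := by
        conv_lhs => rw [h₂]
        rw [sub_mul, one_mul, smul_mul_assoc, mul_assoc]
      rw [matR, h₃, two_smul]
      abel
    rwa [this]
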